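/- Let $n$ be a non-negative integer and let $Q_n$ be the hypercube, i.e. the power set of $[n]=\{1,\dots,n\}$ with the metric $d(x,y)=|x\,\Delta\,y|$. For $A\subseteq Q_n$ write $A^c=Q_n\setminus A$ and $N(A)=\{x\in Q_n : d(x,y)\le 1 \text{ for some } y\in A\}$, and say that $N(A)$ is minimal if $|N(A)|\le|N(B)|$ for every $B\subseteq Q_n$ with $|B|=|A|$. Write $X^{(\ge r)}=\{x\subseteq[n] : |x|\ge r\}$. The simplicial order on $Q_n$ is defined by $x<y$ if and only if $|x|<|y|$, or $|x|=|y|$, $x\ne y$ and $\min(x\,\Delta\,y)\in x$. Two subsets of $Q_n$ are isomorphic if some automorphism (distance-preserving bijection) of $Q_n$ maps one onto the other. Suppose that $A\subseteq Q_n$ and that there is an integer $r$ with $X^{(\ge r)}\subseteq A\subseteq X^{(\ge r-1)}$, and suppose that both $N(A)$ and $N(A^c)$ are minimal. Then $A$ is isomorphic to an initial segment (possibly empty) of the simplicial order. -/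

import Mathlib

/-- The vertex set of the `n`-dimensional hypercube: the power set of an `n`-element
linearly ordered ground set. -/
abbrev Cube (n : ℕ) : Type := Finset (Fin n)

namespace Cube

/-- The hypercube metric `d(x, y) = |x Δ y|`. -/
def cubeDist {n : ℕ} (x y : Cube n) : ℕ := (symmDiff x y).card

/-- The (closed) neighbourhood `N(A) = {x : d(x, A) ≤ 1}`; it is empty for empty `A`. -/
def nbhd {n : ℕ} (A : Finset (Cube n)) : Finset (Cube n) :=
  Finset.univ.filter (fun x => ∃ y ∈ A, cubeDist x y ≤ 1)

/-- `N(A)` is minimal: no set of the same size as `A` has a smaller neighbourhood. -/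
def NbhdMinimal {n : ℕ} (A : Finset (Cube n)) : Prop :=
  ∀ B : Finset (Cube n), B.card = A.card → (nbhd A).card ≤ (nbhd B).card

/-- The vertices `x ⊆ [n]` with `|x| ≥ r`. -/
def layersGE (n : ℕ) (r : ℤ) : Finset (Cube n) :=
  Finset.univ.filter (fun x => r ≤ (x.card : ℤ))

/-- The lexicographic order: `x < y` if `min (x Δ y) ∈ x`. -/
def LexLT {n : ℕ} (x y : Cube n) : Prop :=
  ∃ i ∈ x, i ∈ symmDiff x y ∧ ∀ j ∈ symmDiff x y, i ≤ j

/-- The simplicial order. -/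
def SimLT {n : ℕ} (x y : Cube n) : Prop :=
  x.card < y.card ∨ (x.card = y.card ∧ LexLT x y)

/-- `C` is an initial segment of the simplicial order. -/
def IsSimInitialSegment {n : ℕ} (C : Finset (Cube n)) : Prop :=
  ∀ y ∈ C, ∀ x : Cube n, SimLT x y → x ∈ C

/-- `A` and `B` are isomorphic as subsets of the cube: an automorphism (distance-preserving
bijection) of the cube maps `A` onto `B`. -/
def Isomorphic {n : ℕ} (A B : Finset (Cube n)) : Prop :=
  ∃ φ : Cube n ≃ Cube n, (∀ x y, cubeDist (φ x) (φ y) = cubeDist x y) ∧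
    A.map φ.toEmbedding = B

end Cube

/-! Let `B` be the family of `k`-sets in the one layer that `A` fills only partly. Apart from the
degenerate layers `k = 0` and `k = n`, `N(A)` has a fixed number of points plus the lower shadow of
`B`, and `N(Aᶜ)` has a fixed number of points minus the `(k + 1)`-sets filled by `B`. So `B` has the
least shadow and the most filled sets for its size (`Optimal`), and such a `B` must be a relabelled
initial segment.

The heart is `Optimal.exists_vertex`: some vertex is isolated (in no member) or coisolated (all
`k`-sets avoiding it are members). Removing that vertex leaves an optimal family, so induction
produces the labelling.

To find the vertex, split `B` at a vertex `i` of at most average degree into the members `B₀`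
avoiding `i` and the link `B₁`. Kruskal–Katona and local LYM provide nested extremal families of the
same two sizes; comparison with them shows that both halves are optimal, `B₁ ⊆ ∂ B₀` and `fill B₁ ⊆
B₀`. By induction each half has an isolated or a coisolated vertex, and the two inclusions pass this
on to `B`, except when `B₀` has a coisolated vertex `v` and `B₁` an isolated vertex `w`. Then the
link of `v` in `B₀` and a transposed copy of `B₁` can be varied independently: they form an optimal
pair. Uncrossing such a pair with all transposed copies of one family forces one of the two families
to be empty or full, which settles this case. -/

namespace LayerFamily

open Finset
open scoped FinsetFamily

set_option linter.unusedSectionVars false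

/-! ### Shadows, filled sets and splitting at a vertex. -/

section

variable {α β : Type*} [DecidableEq α] [DecidableEq β]

/-- The `(k + 1)`-subsets of `S` all of whose `k`-subsets belong to `B`. -/
def fill (S : Finset α) (k : ℕ) (B : Finset (Finset α)) : Finset (Finset α) :=
  (S.powersetCard (k + 1)).filter fun y => ∀ p ∈ y, y.erase p ∈ B

lemma mem_fill {S : Finset α} {k : ℕ} {B : Finset (Finset α)} {y : Finset α} :
    y ∈ fill S k B ↔ (y ⊆ S ∧ y.card = k + 1) ∧ ∀ p ∈ y, y.erase p ∈ B := by
  simp [fill, mem_powersetCard]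

lemma fill_subset (S : Finset α) (k : ℕ) (B : Finset (Finset α)) :
    fill S k B ⊆ S.powersetCard (k + 1) := filter_subset _ _

lemma fill_mono {S : Finset α} {k : ℕ} {B B' : Finset (Finset α)} (h : B ⊆ B') :
    fill S k B ⊆ fill S k B' := fun y hy => by
  rw [mem_fill] at hy ⊢
  exact ⟨hy.1, fun p hp => h (hy.2 p hp)⟩

lemma shadow_fill_subset (S : Finset α) (k : ℕ) (B : Finset (Finset α)) :
    ∂ (fill S k B) ⊆ B := fun z hz => by
  obtain ⟨s, hs, a, ha, rfl⟩ := mem_shadow_iff.1 hz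
  exact (mem_fill.1 hs).2 a ha

lemma subset_fill {S : Finset α} {k : ℕ} {B D : Finset (Finset α)}
    (hD : D ⊆ S.powersetCard (k + 1)) (h : ∂ D ⊆ B) : D ⊆ fill S k B := fun y hy => by
  rw [mem_fill, ← mem_powersetCard]
  exact ⟨hD hy, fun p hp => h (erase_mem_shadow hy hp)⟩

lemma shadow_union (A B : Finset (Finset α)) : ∂ (A ∪ B) = ∂ A ∪ ∂ B := by
  ext z
  simp only [mem_shadow_iff, mem_union]
  grind

lemma powersetCard_subset_shadow {C : Finset α} {k : ℕ} (h : k + 1 ≤ C.card) :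
    C.powersetCard k ⊆ ∂ (C.powersetCard (k + 1)) := fun z hz => by
  obtain ⟨hz, hk⟩ := mem_powersetCard.1 hz
  obtain ⟨a, ha, haz⟩ : ∃ a ∈ C, a ∉ z := by
    by_contra! hc
    have := card_le_card (show C ⊆ z from hc)
    omega
  refine mem_shadow_iff_insert_mem.2 ⟨a, haz, mem_powersetCard.2 ⟨?_, ?_⟩⟩
  · exact insert_subset ha hz
  · rw [card_insert_of_notMem haz, hk]

/-- If `v` lies in no member of `F`, adding `v` to the ground set creates no filled sets. -/
lemma fill_insert_eq {C : Finset α} {k : ℕ} {v : α} {F : Finset (Finset α)}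
    (hF : F ⊆ C.powersetCard (k + 1)) : fill (insert v C) (k + 1) F = fill C (k + 1) F := by
  ext y
  simp only [mem_fill]
  refine ⟨fun ⟨⟨_, h⟩, h'⟩ => ⟨⟨fun a ha => ?_, h⟩, h'⟩,
    fun ⟨⟨h₀, h⟩, h'⟩ => ⟨⟨h₀.trans (subset_insert _ _), h⟩, h'⟩⟩
  obtain ⟨b, hb, hba⟩ := exists_mem_ne (show 1 < y.card by omega) a
  exact (mem_powersetCard.1 (hF (h' b hb))).1 (mem_erase.2 ⟨hba.symm, ha⟩)

lemma nonMemberSubfamily_shadow (i : α) (B : Finset (Finset α)) :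
    (∂ B).nonMemberSubfamily i = B.memberSubfamily i ∪ ∂ (B.nonMemberSubfamily i) := by
  ext t
  simp only [mem_nonMemberSubfamily, mem_memberSubfamily, mem_shadow_iff_insert_mem, mem_union]
  grind

lemma memberSubfamily_shadow (i : α) (B : Finset (Finset α)) :
    (∂ B).memberSubfamily i = ∂ (B.memberSubfamily i) := by
  ext t
  simp only [mem_memberSubfamily, mem_shadow_iff_insert_mem]
  constructor
  · rintro ⟨⟨a, ha, h⟩, hi⟩
    refine ⟨a, fun h' => ha (mem_insert_of_mem h'), ?_, ?_⟩
    · rwa [insert_comm]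
    · grind
  · rintro ⟨a, ha, h, hi⟩
    refine ⟨⟨a, ?_, ?_⟩, ?_⟩
    · grind
    · rwa [insert_comm]
    · grind

/-- A shadow set avoiding `i` arises by deleting `i` from a member through `i`, or any element from
a member avoiding `i`; a shadow set through `i` comes only from the link. -/
lemma card_shadow_split (i : α) (B : Finset (Finset α)) :
    (∂ B).card = (B.memberSubfamily i ∪ ∂ (B.nonMemberSubfamily i)).card +
      (∂ (B.memberSubfamily i)).card := by
  rw [← card_memberSubfamily_add_card_nonMemberSubfamily i (∂ B), nonMemberSubfamily_shadow,
    memberSubfamily_shadow, add_comm]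

/-- For a filled set `insert i z`, deleting `i` requires `z ∈ B`, and deleting any other element is
a condition on the link of `i`. -/
lemma card_fill_split {S : Finset α} {i : α} (hi : i ∉ S) (k : ℕ) (B : Finset (Finset α)) :
    (fill (insert i S) (k + 1) B).card = (fill S (k + 1) (B.nonMemberSubfamily i)).card +
      (B.nonMemberSubfamily i ∩ fill S k (B.memberSubfamily i)).card := by
  rw [← card_memberSubfamily_add_card_nonMemberSubfamily i (fill (insert i S) (k + 1) B), add_comm]
  congr 2
  · ext y
    simp only [mem_nonMemberSubfamily, mem_fill]
    constructor
    · rintro ⟨⟨⟨h₁, h₂⟩, h₃⟩, h₄⟩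
      exact ⟨⟨(subset_insert_iff_of_notMem h₄).1 h₁, h₂⟩, fun p hp => ⟨h₃ p hp, by grind⟩⟩
    · rintro ⟨⟨h₁, h₂⟩, h₃⟩
      exact ⟨⟨⟨h₁.trans (subset_insert _ _), h₂⟩, fun p hp => (h₃ p hp).1⟩, fun h => hi (h₁ h)⟩
  · ext z
    simp only [mem_nonMemberSubfamily, mem_memberSubfamily, mem_fill, mem_inter]
    constructor
    · rintro ⟨⟨⟨h₁, h₂⟩, h₃⟩, h₄⟩
      rw [card_insert_of_notMem h₄] at h₂
      refine ⟨⟨?_, h₄⟩, ⟨(insert_subset_insert_iff h₄).1 h₁, by omega⟩, fun p hp => ⟨?_, by grind⟩⟩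
      · simpa [h₄] using h₃ i (mem_insert_self _ _)
      · rw [← erase_insert_of_ne (by grind)]
        exact h₃ p (mem_insert_of_mem hp)
    · rintro ⟨⟨h₀, h₄⟩, ⟨h₁, h₂⟩, h₃⟩
      refine ⟨⟨⟨by grind, by rw [card_insert_of_notMem h₄, h₂]⟩, fun p hp => ?_⟩, h₄⟩
      rcases mem_insert.1 hp with rfl | hp
      · rwa [erase_insert h₄]
      · rw [erase_insert_of_ne (by grind)]
        exact (h₃ p hp).1

/-- The family whose members avoiding `i` form `B₀` and whose link at `i` is `B₁`. -/
def glue (i : α) (B₀ B₁ : Finset (Finset α)) : Finset (Finset α) := B₀ ∪ B₁.image (insert i)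

section Glue

variable {S : Finset α} {i : α} {k : ℕ} {B₀ B₁ B : Finset (Finset α)}

lemma nonMemberSubfamily_glue (h₀ : ∀ x ∈ B₀, i ∉ x) :
    (glue i B₀ B₁).nonMemberSubfamily i = B₀ := by
  ext x
  simp only [glue, mem_nonMemberSubfamily, mem_union, mem_image]
  grind

lemma memberSubfamily_glue (h₀ : ∀ x ∈ B₀, i ∉ x) (h₁ : ∀ x ∈ B₁, i ∉ x) :
    (glue i B₀ B₁).memberSubfamily i = B₁ := by
  ext x
  simp only [glue, mem_memberSubfamily, mem_union, mem_image]
  constructor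
  · rintro ⟨h | ⟨a, ha, h⟩, hi⟩
    · exact absurd (mem_insert_self _ _) (h₀ _ h)
    · have := congrArg (fun s => s.erase i) h
      simp only [erase_insert (h₁ a ha), erase_insert hi] at this
      exact this ▸ ha
  · exact fun h => ⟨Or.inr ⟨x, h, rfl⟩, h₁ x h⟩

lemma notMem_of_subset_powersetCard (hi : i ∉ S) (h : B ⊆ S.powersetCard k) :
    ∀ x ∈ B, i ∉ x := fun _ hx hix => hi ((mem_powersetCard.1 (h hx)).1 hix)

lemma glue_subset (hi : i ∉ S) (h₀ : B₀ ⊆ S.powersetCard (k + 1)) (h₁ : B₁ ⊆ S.powersetCard k) :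
    glue i B₀ B₁ ⊆ (insert i S).powersetCard (k + 1) := by
  intro x hx
  simp only [glue, mem_union, mem_image] at hx
  rcases hx with hx | ⟨y, hy, rfl⟩
  · exact powersetCard_mono (subset_insert _ _) (h₀ hx)
  · have := mem_powersetCard.1 (h₁ hy)
    rw [mem_powersetCard, card_insert_of_notMem (fun h => hi (this.1 h)), this.2]
    exact ⟨insert_subset_insert _ this.1, rfl⟩

lemma card_glue (h₀ : ∀ x ∈ B₀, i ∉ x) (h₁ : ∀ x ∈ B₁, i ∉ x) :
    (glue i B₀ B₁).card = B₀.card + B₁.card := by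
  rw [← card_memberSubfamily_add_card_nonMemberSubfamily i, memberSubfamily_glue h₀ h₁,
    nonMemberSubfamily_glue h₀, add_comm]

lemma card_shadow_of_member_subset (h : B.memberSubfamily i ⊆ ∂ (B.nonMemberSubfamily i)) :
    (∂ B).card = (∂ (B.nonMemberSubfamily i)).card + (∂ (B.memberSubfamily i)).card := by
  rw [card_shadow_split i, union_eq_right.2 h]

lemma card_fill_of_fill_subset (hi : i ∉ S)
    (h : fill S k (B.memberSubfamily i) ⊆ B.nonMemberSubfamily i) :
    (fill (insert i S) (k + 1) B).card = (fill S (k + 1) (B.nonMemberSubfamily i)).card +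
      (fill S k (B.memberSubfamily i)).card := by
  rw [card_fill_split hi, inter_eq_right.2 h]

lemma card_shadow_glue (h₀ : ∀ x ∈ B₀, i ∉ x) (h₁ : ∀ x ∈ B₁, i ∉ x) (h : B₁ ⊆ ∂ B₀) :
    (∂ (glue i B₀ B₁)).card = (∂ B₀).card + (∂ B₁).card := by
  rw [card_shadow_of_member_subset (i := i)] <;>
    rw [memberSubfamily_glue h₀ h₁, nonMemberSubfamily_glue h₀]
  exact h

lemma card_fill_glue (hi : i ∉ S) (h₀ : ∀ x ∈ B₀, i ∉ x) (h₁ : ∀ x ∈ B₁, i ∉ x)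
    (h : fill S k B₁ ⊆ B₀) :
    (fill (insert i S) (k + 1) (glue i B₀ B₁)).card =
      (fill S (k + 1) B₀).card + (fill S k B₁).card := by
  rw [card_fill_of_fill_subset hi] <;>
    rw [memberSubfamily_glue h₀ h₁, nonMemberSubfamily_glue h₀]
  exact h

lemma nonMemberSubfamily_subset (h : B ⊆ (insert i S).powersetCard k) :
    B.nonMemberSubfamily i ⊆ S.powersetCard k := fun x hx => by
  rw [mem_nonMemberSubfamily] at hx
  have := mem_powersetCard.1 (h hx.1)
  exact mem_powersetCard.2 ⟨(subset_insert_iff_of_notMem hx.2).1 this.1, this.2⟩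

lemma memberSubfamily_subset (h : B ⊆ (insert i S).powersetCard (k + 1)) :
    B.memberSubfamily i ⊆ S.powersetCard k := fun x hx => by
  rw [mem_memberSubfamily] at hx
  have := mem_powersetCard.1 (h hx.1)
  rw [card_insert_of_notMem hx.2] at this
  refine mem_powersetCard.2 ⟨fun a ha => ?_, by omega⟩
  have := this.1 (mem_insert_of_mem ha)
  grind

end Glue

/-! ### Transport along embeddings of ground sets. -/

/-- The image of a family under an embedding of ground sets. -/
def mapFam (e : α ↪ β) (B : Finset (Finset α)) : Finset (Finset β) :=
  B.map (mapEmbedding e).toEmbedding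

lemma mem_mapFam {e : α ↪ β} {B : Finset (Finset α)} {y : Finset β} :
    y ∈ mapFam e B ↔ ∃ x ∈ B, x.map e = y := by
  simp [mapFam]

lemma card_mapFam (e : α ↪ β) (B : Finset (Finset α)) : (mapFam e B).card = B.card :=
  card_map _

lemma mapFam_subset {e : α ↪ β} {A B : Finset (Finset α)} (h : A ⊆ B) :
    mapFam e A ⊆ mapFam e B := map_subset_map.2 h

lemma mapFam_subset_powersetCard {e : α ↪ β} {B : Finset (Finset α)} {S : Finset α} {k : ℕ}
    (h : B ⊆ S.powersetCard k) : mapFam e B ⊆ (S.map e).powersetCard k := fun y hy => by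
  obtain ⟨x, hx, rfl⟩ := mem_mapFam.1 hy
  have := mem_powersetCard.1 (h hx)
  exact mem_powersetCard.2 ⟨map_subset_map.2 this.1, by rw [card_map, this.2]⟩

lemma shadow_mapFam (e : α ↪ β) (B : Finset (Finset α)) : ∂ (mapFam e B) = mapFam e (∂ B) := by
  ext y
  simp only [mem_shadow_iff, mem_mapFam]
  constructor
  · rintro ⟨_, ⟨x, hx, rfl⟩, a, ha, rfl⟩
    obtain ⟨b, hb, rfl⟩ := mem_map.1 ha
    exact ⟨x.erase b, ⟨x, hx, b, hb, rfl⟩, map_erase _ _ _⟩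
  · rintro ⟨_, ⟨x, hx, b, hb, rfl⟩, rfl⟩
    exact ⟨_, ⟨x, hx, rfl⟩, e b, mem_map_of_mem _ hb, (map_erase _ _ _).symm⟩

lemma mapFam_fill_subset (e : α ↪ β) (S : Finset α) (k : ℕ) (B : Finset (Finset α)) :
    mapFam e (fill S k B) ⊆ fill (S.map e) k (mapFam e B) := by
  refine subset_fill (mapFam_subset_powersetCard (fill_subset _ _ _)) ?_
  rw [shadow_mapFam]
  exact mapFam_subset (shadow_fill_subset _ _ _)

lemma exists_mapFam_eq {e : α ↪ β} {S : Finset α} {k : ℕ} {B : Finset (Finset β)}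
    (h : B ⊆ (S.map e).powersetCard k) : ∃ B' ⊆ S.powersetCard k, mapFam e B' = B := by
  refine ⟨(S.powersetCard k).filter fun x => x.map e ∈ B, filter_subset _ _, ?_⟩
  ext y
  simp only [mem_mapFam, mem_filter]
  constructor
  · rintro ⟨x, hx, rfl⟩
    exact hx.2
  · intro hy
    obtain ⟨h₁, h₂⟩ := mem_powersetCard.1 (h hy)
    obtain ⟨x, hx, rfl⟩ := subset_map_iff.1 h₁
    exact ⟨x, ⟨mem_powersetCard.2 ⟨hx, by rwa [card_map] at h₂⟩, hy⟩, rfl⟩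

end

/-! ### Extremal families from Kruskal–Katona and local LYM. -/

section

variable {α : Type*} [DecidableEq α]

/-- `B` minimises the lower shadow and maximises the filled sets among families of `k`-subsets of
`S` of the same size. -/
structure Optimal (S : Finset α) (k : ℕ) (B : Finset (Finset α)) : Prop where
  subset : B ⊆ S.powersetCard k
  shadow_le : ∀ B' ⊆ S.powersetCard k, B'.card = B.card → (∂ B).card ≤ (∂ B').card
  fill_le : ∀ B' ⊆ S.powersetCard k, B'.card = B.card → (fill S k B').card ≤ (fill S k B).card

lemma exists_isInitSeg (n k m : ℕ) (hm : m ≤ n.choose k) :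
    ∃ J : Finset (Finset (Fin n)), Colex.IsInitSeg J k ∧ J.card = m := by
  induction m with
  | zero => exact ⟨∅, Colex.isInitSeg_empty, rfl⟩
  | succ m ih =>
    obtain ⟨J, hJ, rfl⟩ := ih (by omega)
    have hsub : J ⊆ (univ : Finset (Fin n)).powersetCard k := fun x hx =>
      mem_powersetCard.2 ⟨subset_univ _, hJ.1 hx⟩
    have hne : (((univ : Finset (Fin n)).powersetCard k) \ J).Nonempty := by
      rw [← card_pos, card_sdiff_of_subset hsub, card_powersetCard, card_univ, Fintype.card_fin]
      omega
    obtain ⟨s, hs, hmin⟩ := exists_min_image _ (fun x => toColex x) hne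
    rw [mem_sdiff, mem_powersetCard] at hs
    refine ⟨insert s J, ⟨?_, ?_⟩, card_insert_of_notMem hs.2⟩
    · intro x hx
      rcases mem_insert.1 (mem_coe.1 hx) with rfl | hx
      · exact hs.1.2
      · exact hJ.1 hx
    · rintro x y hx ⟨hlt, hy⟩
      rcases mem_insert.1 hx with rfl | hx
      · by_contra hc
        refine absurd (hmin y ?_) (not_le.2 hlt)
        rw [mem_sdiff, mem_powersetCard]
        exact ⟨⟨subset_univ _, hy⟩, fun h => hc (mem_insert_of_mem h)⟩
      · exact mem_insert_of_mem (hJ.2 hx ⟨hlt, hy⟩)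

/-- The Kruskal-Katona theorem and the local LYM inequality on an arbitrary ground set: there is a
chain of families of every size which is closed under shadows and has minimal shadows. -/
lemma exists_chain (S : Finset α) : ∃ P : ℕ → Finset (Finset α) → Prop,
    (∀ k J, P k J → J ⊆ S.powersetCard k) ∧
    (∀ k m, m ≤ S.card.choose k → ∃ J, P k J ∧ J.card = m) ∧
    (∀ k J J', P k J → P k J' → J ⊆ J' ∨ J' ⊆ J) ∧
    (∀ k J, P (k + 1) J → P k (∂ J)) ∧
    (∀ k J B, P k J → B ⊆ S.powersetCard k → J.card = B.card → (∂ J).card ≤ (∂ B).card) ∧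
    (∀ k J, P k J → J.card * k ≤ (∂ J).card * (S.card - k + 1)) := by
  obtain ⟨e, he⟩ : ∃ e : Fin S.card ↪ α, univ.map e = S := by
    refine ⟨S.equivFin.symm.toEmbedding.trans (Function.Embedding.subtype _), ?_⟩
    ext a
    simp only [mem_map, mem_univ, true_and, Function.Embedding.trans_apply, Equiv.coe_toEmbedding,
      Function.Embedding.subtype_apply]
    exact ⟨fun ⟨x, hx⟩ => hx ▸ (S.equivFin.symm x).2, fun h => ⟨S.equivFin ⟨a, h⟩, by simp⟩⟩
  have hsub : ∀ {k} {J : Finset (Finset (Fin S.card))}, Colex.IsInitSeg J k →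
      J ⊆ (univ : Finset (Fin S.card)).powersetCard k := fun hJ x hx =>
    mem_powersetCard.2 ⟨subset_univ _, hJ.1 hx⟩
  -- The chain consists of the images of the colex initial segments.
  refine ⟨fun k J => ∃ J₀, Colex.IsInitSeg J₀ k ∧ mapFam e J₀ = J, ?_, ?_, ?_, ?_, ?_, ?_⟩
  · rintro k _ ⟨J, hJ, rfl⟩
    have := mapFam_subset_powersetCard (e := e) (hsub hJ)
    rwa [he] at this
  · intro k m hm
    obtain ⟨J, hJ, hc⟩ := exists_isInitSeg S.card k m hm
    exact ⟨_, ⟨J, hJ, rfl⟩, by rw [card_mapFam, hc]⟩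
  · rintro k _ _ ⟨J, hJ, rfl⟩ ⟨J', hJ', rfl⟩
    exact (hJ.total hJ').imp mapFam_subset mapFam_subset
  · rintro k _ ⟨J, hJ, rfl⟩
    exact ⟨_, hJ.shadow, (shadow_mapFam e J).symm⟩
  · rintro k _ B ⟨J, hJ, rfl⟩ hB hc
    rw [← he] at hB
    obtain ⟨B', hB', rfl⟩ := exists_mapFam_eq hB
    rw [shadow_mapFam, shadow_mapFam, card_mapFam, card_mapFam]
    rw [card_mapFam, card_mapFam] at hc
    exact kruskal_katona (fun x hx => (mem_powersetCard.1 (hB' hx)).2) hc.le hJ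
  · rintro k _ ⟨J, hJ, rfl⟩
    rw [shadow_mapFam, card_mapFam, card_mapFam]
    have := card_mul_le_card_shadow_mul hJ.1
    rwa [Fintype.card_fin] at this

/-- Extremal families of sizes `b₀` and `b₁` in consecutive layers, nested as far as sizes allow. -/
lemma exists_nested_optimal {S : Finset α} {k b₀ b₁ : ℕ} (hk : k + 1 ≤ S.card)
    (h₀ : b₀ ≤ S.card.choose (k + 1)) (h₁ : b₁ ≤ S.card.choose k)
    (hb : b₁ * (S.card - k) ≤ b₀ * (k + 1)) :
    ∃ J₀ J₁, Optimal S (k + 1) J₀ ∧ Optimal S k J₁ ∧ J₀.card = b₀ ∧ J₁.card = b₁ ∧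
      J₁ ⊆ ∂ J₀ ∧ fill S k J₁ ⊆ J₀ := by
  obtain ⟨P, hsub, hex, htot, hsh, hmin, hlym⟩ := exists_chain S
  have le_of {k J J'} (h : P k J) (h' : P k J') (hc : J.card ≤ J'.card) : J ⊆ J' := by
    rcases htot k J J' h h' with h | h
    · exact h
    · exact (eq_of_subset_of_card_le h hc).symm.subset
  -- Chain members also maximise filled sets: a chain member `J'` of size `|fill B|` has shadow of
  -- size at most `|B| = |J|`, so `∂ J' ⊆ J` and `J'` is filled by `J`.
  have key {k J B} (hJ : P k J) (hB : B ⊆ S.powersetCard k) (hc : B.card = J.card) :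
      ∃ J', P (k + 1) J' ∧ J'.card = (fill S k B).card ∧ J' ⊆ fill S k J := by
    obtain ⟨J', hJ', hc'⟩ := hex (k + 1) (fill S k B).card (by
      rw [← card_powersetCard]
      exact card_le_card (fill_subset _ _ _))
    refine ⟨J', hJ', hc', subset_fill (hsub _ _ hJ') (le_of (hsh _ _ hJ') hJ ?_)⟩
    rw [← hc]
    exact (hmin _ _ _ hJ' (fill_subset _ _ _) hc').trans (card_le_card (shadow_fill_subset _ _ _))
  have opt {k J} (hJ : P k J) : Optimal S k J := by
    refine ⟨hsub _ _ hJ, fun B hB hc => hmin _ _ _ hJ hB hc.symm, fun B hB hc => ?_⟩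
    obtain ⟨J', -, hc', h⟩ := key hJ hB hc
    exact hc' ▸ card_le_card h
  obtain ⟨J₀, hJ₀, rfl⟩ := hex _ _ h₀
  obtain ⟨J₁, hJ₁, rfl⟩ := hex _ _ h₁
  refine ⟨J₀, J₁, opt hJ₀, opt hJ₁, rfl, rfl, le_of hJ₁ (hsh _ _ hJ₀) ?_, ?_⟩
  -- Local LYM in layer `k + 1` is exactly what turns `hb` into `b₁ ≤ |∂ J₀|`; applied to `fill S k
  -- J₁` below, it gives `|fill S k J₁| ≤ b₀`.
  · have := hlym _ _ hJ₀
    rw [show S.card - (k + 1) + 1 = S.card - k by omega] at this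
    exact Nat.le_of_mul_le_mul_right (hb.trans this) (by omega)
  · obtain ⟨J', hJ', hc', h⟩ := key hJ₁ (hsub _ _ hJ₁) rfl
    rw [← eq_of_subset_of_card_le h hc'.ge]
    refine le_of hJ' hJ₀ ?_
    have h₁ := hlym _ _ hJ'
    rw [show S.card - (k + 1) + 1 = S.card - k by omega] at h₁
    have h₂ : (∂ J').card ≤ J₁.card :=
      card_le_card ((shadow_mono h).trans (shadow_fill_subset _ _ _))
    exact Nat.le_of_mul_le_mul_right
      (h₁.trans ((Nat.mul_le_mul_right _ h₂).trans hb)) (by omega)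

/-- The degrees sum to `|B| * k`, so a vertex of least degree is at most average. -/
lemma exists_low_degree {S : Finset α} (hS : S.Nonempty) {k : ℕ} {B : Finset (Finset α)}
    (hB : B ⊆ S.powersetCard k) :
    ∃ i ∈ S, (B.memberSubfamily i).card * S.card ≤ B.card * k := by
  have hsum : ∑ i ∈ S, (B.memberSubfamily i).card = B.card * k := by
    have h (i : α) : (B.memberSubfamily i).card = (B.filter fun x => i ∈ x).card := by
      rw [memberSubfamily, card_image_of_injOn]
      exact (erase_injOn' _).mono (by simp)
    simp_rw [h]
    refine (sum_card_bipartiteAbove_eq_sum_card_bipartiteBelow (fun i x => i ∈ x)).trans ?_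
    refine sum_const_nat fun x hx => ?_
    obtain ⟨h₁, h₂⟩ := mem_powersetCard.1 (hB hx)
    rw [← h₂]
    congr 1
    ext a
    simp only [bipartiteBelow, mem_filter]
    exact ⟨fun h => h.2, fun h => ⟨h₁ h, h⟩⟩
  obtain ⟨i, hi, h⟩ := exists_min_image S (fun i => (B.memberSubfamily i).card) hS
  refine ⟨i, hi, ?_⟩
  rw [← hsum, mul_comm]
  exact card_nsmul_le_sum _ _ _ h

/-- At a vertex of low degree, both halves of an optimal family are optimal. -/
lemma Optimal.split {S : Finset α} {i : α} (hi : i ∉ S) {k : ℕ} {B : Finset (Finset α)}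
    (hB : Optimal (insert i S) (k + 1) B) (hk : k + 1 ≤ S.card)
    (hdeg : (B.memberSubfamily i).card * (S.card + 1) ≤ B.card * (k + 1)) :
    Optimal S (k + 1) (B.nonMemberSubfamily i) ∧ Optimal S k (B.memberSubfamily i) ∧
      B.memberSubfamily i ⊆ ∂ (B.nonMemberSubfamily i) ∧
      fill S k (B.memberSubfamily i) ⊆ B.nonMemberSubfamily i := by
  have hcard := card_memberSubfamily_add_card_nonMemberSubfamily i B
  have hsub₀ := nonMemberSubfamily_subset hB.subset
  have hsub₁ := memberSubfamily_subset hB.subset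
  have hsh := card_shadow_split i B
  have hfi := card_fill_split hi k B
  set B₀ := B.nonMemberSubfamily i
  set B₁ := B.memberSubfamily i
  -- The degree bound with `|B| = |B₀| + |B₁|` substituted.
  have hb : B₁.card * (S.card - k) ≤ B₀.card * (k + 1) := by
    obtain ⟨c, hc⟩ : ∃ c, S.card = k + c := ⟨S.card - k, by omega⟩
    rw [hc, show k + c - k = c by omega]
    rw [hc, ← hcard] at hdeg
    nlinarith
  obtain ⟨J₀, J₁, hJ₀, hJ₁, hc₀, hc₁, hs, hf⟩ := exists_nested_optimal hk
    (by rw [← card_powersetCard]; exact card_le_card hsub₀)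
    (by rw [← card_powersetCard]; exact card_le_card hsub₁) hb
  have hi₀ := notMem_of_subset_powersetCard hi hJ₀.subset
  have hi₁ := notMem_of_subset_powersetCard hi hJ₁.subset
  have hglue := glue_subset hi hJ₀.subset hJ₁.subset
  have hgc : (glue i J₀ J₁).card = B.card := by rw [card_glue hi₀ hi₁]; omega
  have e₁ := hB.shadow_le _ hglue hgc
  have e₂ := hB.fill_le _ hglue hgc
  rw [card_shadow_glue hi₀ hi₁ hs, hsh] at e₁
  rw [card_fill_glue hi hi₀ hi₁ hf, hfi] at e₂
  -- The glued family has shadow `|∂ J₀| + |∂ J₁|`, a lower bound for that of `B`, and dually for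
  -- filled sets. Optimality of `B` forces equality in every estimate, hence optimal halves and both
  -- inclusions.
  have a₀ := hJ₀.shadow_le B₀ hsub₀ hc₀.symm
  have a₁ := hJ₁.shadow_le B₁ hsub₁ hc₁.symm
  have f₀ := hJ₀.fill_le B₀ hsub₀ hc₀.symm
  have f₁ := hJ₁.fill_le B₁ hsub₁ hc₁.symm
  have u : (∂ B₀).card ≤ (B₁ ∪ ∂ B₀).card := card_le_card subset_union_right
  have w : (B₀ ∩ fill S k B₁).card ≤ (fill S k B₁).card := card_le_card inter_subset_right
  refine ⟨⟨hsub₀, fun B' h h' => ?_, fun B' h h' => ?_⟩,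
    ⟨hsub₁, fun B' h h' => ?_, fun B' h h' => ?_⟩, ?_, ?_⟩
  · have := hJ₀.shadow_le B' h (h'.trans hc₀.symm); omega
  · have := hJ₀.fill_le B' h (h'.trans hc₀.symm); omega
  · have := hJ₁.shadow_le B' h (h'.trans hc₁.symm); omega
  · have := hJ₁.fill_le B' h (h'.trans hc₁.symm); omega
  · rw [← union_eq_right]
    exact (eq_of_subset_of_card_le subset_union_right (by omega)).symm
  · rw [← inter_eq_right]
    exact eq_of_subset_of_card_le inter_subset_right (by omega)

end

/-! ### Transpositions of the ground set. -/

section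

variable {α : Type*} [DecidableEq α]

/-- The image of a family under the transposition of two points. -/
def swapFam (p q : α) (F : Finset (Finset α)) : Finset (Finset α) :=
  mapFam (Equiv.swap p q).toEmbedding F

lemma map_swap_map_swap (p q : α) (x : Finset α) :
    (x.map (Equiv.swap p q).toEmbedding).map (Equiv.swap p q).toEmbedding = x := by
  ext a
  simp [mem_map_equiv]

lemma mem_swapFam {p q : α} {F : Finset (Finset α)} {y : Finset α} :
    y ∈ swapFam p q F ↔ y.map (Equiv.swap p q).toEmbedding ∈ F := by
  rw [swapFam, mem_mapFam]
  constructor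
  · rintro ⟨x, hx, rfl⟩
    rwa [map_swap_map_swap]
  · exact fun h => ⟨_, h, map_swap_map_swap _ _ _⟩

lemma map_swap_eq {C : Finset α} {p q : α} (hp : p ∈ C) (hq : q ∈ C) :
    C.map (Equiv.swap p q).toEmbedding = C := by
  refine eq_of_subset_of_card_le (fun a ha => ?_) (by rw [card_map])
  obtain ⟨b, hb, rfl⟩ := mem_map.1 ha
  simp only [Equiv.coe_toEmbedding, Equiv.swap_apply_def]
  split_ifs <;> assumption

lemma map_swap_mem_powersetCard {C x : Finset α} {p q : α} {k : ℕ} (hp : p ∈ C) (hq : q ∈ C)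
    (hx : x ∈ C.powersetCard k) : x.map (Equiv.swap p q).toEmbedding ∈ C.powersetCard k := by
  rw [mem_powersetCard] at hx ⊢
  refine ⟨?_, by rw [card_map, hx.2]⟩
  have := map_subset_map (f := (Equiv.swap p q).toEmbedding).2 hx.1
  rwa [map_swap_eq hp hq] at this

lemma swapFam_subset {C : Finset α} {p q : α} {k : ℕ} (hp : p ∈ C) (hq : q ∈ C)
    {F : Finset (Finset α)} (hF : F ⊆ C.powersetCard k) : swapFam p q F ⊆ C.powersetCard k :=
  fun y hy => by
    have := map_swap_mem_powersetCard hp hq (hF (mem_swapFam.1 hy))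
    rwa [map_swap_map_swap] at this

lemma map_swap_of_mem_iff {x : Finset α} {p q : α} (h : p ∈ x ↔ q ∈ x) :
    x.map (Equiv.swap p q).toEmbedding = x := by
  ext a
  simp only [mem_map_equiv, Equiv.symm_swap, Equiv.swap_apply_def]
  split_ifs with h₁ h₂
  · rw [h₁, h]
  · rw [h₂, h]
  · rfl

lemma map_swap_of_mem {x : Finset α} {p q : α} (hp : p ∈ x) (hq : q ∉ x) :
    x.map (Equiv.swap p q).toEmbedding = insert q (x.erase p) := by
  ext a
  simp only [mem_map_equiv, Equiv.symm_swap, Equiv.swap_apply_def, mem_insert, mem_erase]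
  split_ifs with h₁ h₂
  · grind
  · grind
  · grind

/-- A set moved by a transposition is adjacent to its image. -/
lemma exists_erase_eq_of_map_swap_ne {x : Finset α} {p q : α}
    (h : x.map (Equiv.swap p q).toEmbedding ≠ x) :
    ∃ a ∈ x, ∃ b ∉ x, x.map (Equiv.swap p q).toEmbedding = insert b (x.erase a) := by
  by_cases hp : p ∈ x
  · by_cases hq : q ∈ x
    · exact absurd (map_swap_of_mem_iff (iff_of_true hp hq)) h
    · exact ⟨p, hp, q, hq, map_swap_of_mem hp hq⟩
  · by_cases hq : q ∈ x
    · exact ⟨q, hq, p, hp, by rw [Equiv.swap_comm, map_swap_of_mem hq hp]⟩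
    · exact absurd (map_swap_of_mem_iff (iff_of_false hp hq)) h

/-- Transpositions act transitively on the `k`-subsets of `C`. -/
lemma exists_swap_closed {C : Finset α} {k : ℕ} {Q : Finset (Finset α) → Prop}
    (hQ : ∀ F, Q F → ∀ p ∈ C, ∀ q ∈ C, Q (swapFam p q F)) {x : Finset α}
    (hx : x ∈ C.powersetCard k) {y : Finset α} (hy : y ∈ C.powersetCard k)
    {F : Finset (Finset α)} (hF : Q F) : ∃ G, Q G ∧ (x ∈ G ↔ y ∈ F) := by
  induction hd : (x \ y).card generalizing y F with
  | zero =>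
    rw [card_eq_zero, sdiff_eq_empty_iff_subset] at hd
    rw [mem_powersetCard] at hx hy
    rw [eq_of_subset_of_card_le hd (by omega)]
    exact ⟨F, hF, Iff.rfl⟩
  | succ d ih =>
    have hx' := mem_powersetCard.1 hx
    have hy' := mem_powersetCard.1 hy
    obtain ⟨q, hq⟩ : (x \ y).Nonempty := card_pos.1 (by omega)
    have hd' : (y \ x).card = d + 1 := by
      rw [card_sdiff_comm (hy'.2.trans hx'.2.symm), hd]
    obtain ⟨p, hp⟩ : (y \ x).Nonempty := card_pos.1 (by omega)
    rw [mem_sdiff] at hp hq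
    have hpC := hy'.1 hp.1
    have hqC := hx'.1 hq.1
    -- Exchanging `p ∈ y \ x` with `q ∈ x \ y` brings `y` one step closer to `x`.
    obtain ⟨G, hG, h⟩ := ih (map_swap_mem_powersetCard hpC hqC hy) (hQ F hF p hpC q hqC) (by
      rw [map_swap_of_mem hp.1 hq.2]
      have : x \ insert q (y.erase p) = (x \ y).erase q := by
        ext a
        simp only [mem_sdiff, mem_insert, mem_erase]
        grind
      rw [this, card_erase_of_mem (mem_sdiff.2 hq), hd]
      rfl)
    exact ⟨G, hG, by rw [h, mem_swapFam, map_swap_map_swap]⟩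

/-! ### Uncrossing optimal pairs. -/

/-- The pair `(E, F)` minimises the total shadow and maximises the total number of filled sets
among pairs of families of `k`-subsets of `C` of the same total size. -/
structure PairOptimal (C : Finset α) (k : ℕ) (E F : Finset (Finset α)) : Prop where
  left : E ⊆ C.powersetCard k
  right : F ⊆ C.powersetCard k
  shadow_le : ∀ E' ⊆ C.powersetCard k, ∀ F' ⊆ C.powersetCard k,
    E'.card + F'.card = E.card + F.card →
      (∂ E).card + (∂ F).card ≤ (∂ E').card + (∂ F').card
  fill_le : ∀ E' ⊆ C.powersetCard k, ∀ F' ⊆ C.powersetCard k,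
    E'.card + F'.card = E.card + F.card →
      (fill C k E').card + (fill C k F').card ≤ (fill C k E).card + (fill C k F).card

namespace PairOptimal

variable {C : Finset α} {k : ℕ} {E F : Finset (Finset α)}

lemma of_le (h : PairOptimal C k E F) {E' F' : Finset (Finset α)} (hE : E' ⊆ C.powersetCard k)
    (hF : F' ⊆ C.powersetCard k) (hc : E'.card + F'.card = E.card + F.card)
    (hs : (∂ E').card + (∂ F').card ≤ (∂ E).card + (∂ F).card)
    (hf : (fill C k E).card + (fill C k F).card ≤ (fill C k E').card + (fill C k F').card) :
    PairOptimal C k E' F' where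
  left := hE
  right := hF
  shadow_le E'' hE' F'' hF' hc' := hs.trans (h.shadow_le E'' hE' F'' hF' (hc'.trans hc))
  fill_le E'' hE' F'' hF' hc' := (h.fill_le E'' hE' F'' hF' (hc'.trans hc)).trans hf

lemma swap (h : PairOptimal C k E F) {p q : α} (hp : p ∈ C) (hq : q ∈ C) :
    PairOptimal C k E (swapFam p q F) := by
  refine h.of_le h.left (swapFam_subset hp hq h.right) ?_ ?_ ?_
  · rw [swapFam, card_mapFam]
  · rw [swapFam, shadow_mapFam, card_mapFam]
  · have := card_le_card (mapFam_fill_subset (Equiv.swap p q).toEmbedding C k F)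
    rw [card_mapFam, map_swap_eq hp hq] at this
    exact Nat.add_le_add_left this _

/-- Shadow size is submodular and filled-set count supermodular, so uncrossing can only improve the
pair. By optimality nothing improves, and the two inclusions behind these inequalities become
equalities. -/
lemma inter_union (h : PairOptimal C k E F) :
    PairOptimal C k (E ∩ F) (E ∪ F) ∧ ∂ (E ∩ F) = ∂ E ∩ ∂ F ∧
      fill C k (E ∪ F) = fill C k E ∪ fill C k F := by
  have hi : E ∩ F ⊆ C.powersetCard k := inter_subset_left.trans h.left
  have hu : E ∪ F ⊆ C.powersetCard k := union_subset h.left h.right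
  have hc : (E ∩ F).card + (E ∪ F).card = E.card + F.card := by
    rw [add_comm, card_union_add_card_inter]
  have s₁ : ∂ (E ∩ F) ⊆ ∂ E ∩ ∂ F :=
    subset_inter (shadow_mono inter_subset_left) (shadow_mono inter_subset_right)
  have f₁ : fill C k E ∪ fill C k F ⊆ fill C k (E ∪ F) :=
    union_subset (fill_mono subset_union_left) (fill_mono subset_union_right)
  have f₂ : fill C k E ∩ fill C k F = fill C k (E ∩ F) := by
    ext y
    simp only [mem_inter, mem_fill]
    grind
  have s₂ := card_union_add_card_inter (∂ E) (∂ F)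
  have f₃ := card_union_add_card_inter (fill C k E) (fill C k F)
  rw [← shadow_union] at s₂
  rw [f₂] at f₃
  have s₃ := h.shadow_le _ hi _ hu hc
  have f₄ := h.fill_le _ hi _ hu hc
  have s₄ := card_le_card s₁
  have f₅ := card_le_card f₁
  exact ⟨h.of_le hi hu hc (by omega) (by omega), eq_of_subset_of_card_le s₁ (by omega),
    (eq_of_subset_of_card_le f₁ (by omega)).symm⟩

/-- An optimal pair contains an empty or a full family. -/
theorem eq_empty_or_eq_powersetCard (h : PairOptimal C k E F) :
    (E = ∅ ∨ E = C.powersetCard k) ∨ (F = ∅ ∨ F = C.powersetCard k) := by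
  induction hn : E.card using Nat.strong_induction_on generalizing E F with
  | _ n ih =>
  subst hn
  by_contra! hcon
  obtain ⟨⟨hE₀, hE₁⟩, hF₀, hF₁⟩ := hcon
  have hE₁' : ∃ x ∈ C.powersetCard k, x ∉ E := by
    by_contra! hc
    exact hE₁ (h.left.antisymm hc)
  -- Unless `E ⊆ F`, the pair `(E ∩ F, E ∪ F)` has a smaller first family, so the induction
  -- hypothesis applies to it.
  have step {F} (h : PairOptimal C k E F) (hF₁ : F ≠ C.powersetCard k) :
      E ⊆ F ∨ E ∩ F = ∅ ∨ E ∪ F = C.powersetCard k := by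
    by_contra! hc
    obtain ⟨h₁, h₂, h₃⟩ := hc
    have hss : E ∩ F ⊂ E := inter_subset_left.ssubset_of_ne fun he => h₁ (inter_eq_left.1 he)
    rcases ih _ (card_lt_card hss) h.inter_union.1 rfl with (h' | h') | h' | h'
    · exact h₂.ne_empty h'
    · exact hE₁ (h.left.antisymm (h' ▸ hss.subset))
    · exact hE₀.ne_empty (subset_empty.1 (h' ▸ subset_union_left))
    · exact h₃ h'
  have swap_ne {F} (hF : F ⊆ C.powersetCard k) (hF₁ : F ≠ C.powersetCard k) (p) (hp : p ∈ C) (q)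
      (hq : q ∈ C) : swapFam p q F ≠ C.powersetCard k := fun hc => hF₁ <| hF.antisymm fun x hx => by
    have := map_swap_mem_powersetCard hp hq hx
    rw [← hc, mem_swapFam, map_swap_map_swap] at this
    exact this
  -- If `E ⊆ F`, this inclusion survives every transposition of `F`; by transitivity each `k`-set
  -- then lies in `F`, which would be full.
  have not_subset {F} (h : PairOptimal C k E F) (hF₁ : F ≠ C.powersetCard k) : ¬ E ⊆ F := by
    intro hsub
    refine hF₁ (h.right.antisymm fun y hy => ?_)
    obtain ⟨x, hx⟩ := hE₀
    obtain ⟨G, hG, hxy⟩ := exists_swap_closed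
      (Q := fun F => PairOptimal C k E F ∧ F ≠ C.powersetCard k ∧ E ⊆ F)
      (by
        rintro F ⟨hF, hF₁, hsub⟩ p hp q hq
        have hF' := hF.swap hp hq
        have hne := swap_ne hF.right hF₁ p hp q hq
        refine ⟨hF', hne, ?_⟩
        rcases step hF' hne with h' | h' | h'
        · exact h'
        · exfalso
          have hx' : x ∉ swapFam p q F := fun hc => notMem_empty x (h' ▸ mem_inter.2 ⟨hx, hc⟩)
          rw [mem_swapFam] at hx'
          -- `x` and its image differ by one exchange, so they share a shadow element, whereas `∂ E
          -- ∩ ∂ F'` equals the shadow of the empty intersection.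
          obtain ⟨a, ha, b, hb, hab⟩ := exists_erase_eq_of_map_swap_ne (x := x) (p := p) (q := q)
            (fun he => hx' (by rw [he]; exact hsub hx))
          have hmem : insert b (x.erase a) ∈ swapFam p q F := by
            rw [← hab, mem_swapFam, map_swap_map_swap]
            exact hsub hx
          have hz : x.erase a ∈ ∂ E ∩ ∂ (swapFam p q F) :=
            mem_inter.2 ⟨erase_mem_shadow hx ha,
              mem_shadow_iff_insert_mem.2 ⟨b, by grind, hmem⟩⟩
          rw [← hF'.inter_union.2.1, h', shadow_empty] at hz
          exact notMem_empty _ hz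
        · exfalso
          obtain ⟨x, hx, hxF⟩ : ∃ x ∈ C.powersetCard k, x ∉ F := by
            by_contra! hc
            exact hF₁ (hF.right.antisymm hc)
          have hxE : x ∉ E := fun hc => hxF (hsub hc)
          have hx' : x ∈ swapFam p q F := by
            rw [← h'] at hx
            exact (mem_union.1 hx).resolve_left hxE
          rw [mem_swapFam] at hx'
          obtain ⟨a, ha, b, hb, hab⟩ := exists_erase_eq_of_map_swap_ne (x := x) (p := p) (q := q)
            (fun he => hxF (by rwa [he] at hx'))
          have hmem : insert b (x.erase a) ∉ swapFam p q F := by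
            rwa [← hab, mem_swapFam, map_swap_map_swap]
          obtain ⟨hxC, hxk⟩ := mem_powersetCard.1 hx
          have hbC : b ∈ C := by
            have := map_swap_mem_powersetCard hp hq hx
            rw [hab, mem_powersetCard] at this
            exact this.1 (mem_insert_self _ _)
          -- Dual contradiction: the full union fills `insert b x`, but `E` misses `x` and the
          -- transposed family misses the image of `x`, so neither fills it alone.
          have hz : insert b x ∈ fill C k (E ∪ swapFam p q F) := by
            have hc : (insert b x).card = k + 1 := by rw [card_insert_of_notMem hb, hxk]
            refine mem_fill.2 ⟨⟨insert_subset hbC hxC, hc⟩, fun c hcx => ?_⟩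
            rw [h', mem_powersetCard, card_erase_of_mem hcx, hc]
            exact ⟨(erase_subset _ _).trans (insert_subset hbC hxC), rfl⟩
          rw [hF'.inter_union.2.2, mem_union, mem_fill, mem_fill] at hz
          rcases hz with hz | hz
          · exact hxE (by simpa [hb] using hz.2 b (mem_insert_self _ _))
          · refine hmem ?_
            have := hz.2 a (mem_insert_of_mem ha)
            rwa [erase_insert_of_ne (by grind)] at this)
      (h.left hx) hy ⟨h, hF₁, hsub⟩
    exact hxy.1 (hG.2.2 hx)
  -- A full union also survives transpositions; a fixed `x ∉ E` must then lie in every transposed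
  -- copy of `F`, so `F` would be full.
  have not_full {F} (h : PairOptimal C k E F) (hF₁ : F ≠ C.powersetCard k) :
      E ∪ F ≠ C.powersetCard k := by
    intro hun
    refine hF₁ (h.right.antisymm fun y hy => ?_)
    obtain ⟨x, hx, hxE⟩ := hE₁'
    obtain ⟨G, hG, hxy⟩ := exists_swap_closed
      (Q := fun F => PairOptimal C k E F ∧ F ≠ C.powersetCard k ∧ E ∪ F = C.powersetCard k)
      (by
        rintro F ⟨hF, hF₁, hun⟩ p hp q hq
        have hF' := hF.swap hp hq
        have hne := swap_ne hF.right hF₁ p hp q hq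
        refine ⟨hF', hne, ?_⟩
        rcases step hF' hne with h' | h' | h'
        · exact absurd h' (not_subset hF' hne)
        · refine subset_antisymm (union_subset hF'.left hF'.right) fun x hx => ?_
          by_contra hc
          rw [mem_union, not_or, mem_swapFam] at hc
          have h₁ : x ∈ F := (mem_union.1 (hun.symm ▸ hx)).resolve_left hc.1
          have h₂ : x.map (Equiv.swap p q).toEmbedding ∈ E :=
            (mem_union.1 (hun.symm ▸ map_swap_mem_powersetCard hp hq hx)).resolve_right hc.2
          have h₃ : x.map (Equiv.swap p q).toEmbedding ∈ swapFam p q F := by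
            rwa [mem_swapFam, map_swap_map_swap]
          exact notMem_empty _ (h' ▸ mem_inter.2 ⟨h₂, h₃⟩)
        · exact h')
      hx hy ⟨h, hF₁, hun⟩
    exact hxy.1 ((mem_union.1 (hG.2.2.symm ▸ hx)).resolve_left hxE)
  -- Only disjointness remains, but transitivity moves a member of `F` onto a member of `E`.
  obtain ⟨x, hx⟩ := hE₀
  obtain ⟨y, hy⟩ := hF₀
  obtain ⟨G, hG, hxy⟩ := exists_swap_closed
    (Q := fun F => PairOptimal C k E F ∧ F ≠ C.powersetCard k)
    (fun F hF p hp q hq => ⟨hF.1.swap hp hq, swap_ne hF.1.right hF.2 p hp q hq⟩)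
    (h.left hx) (h.right hy) ⟨h, hF₁⟩
  rcases step hG.1 hG.2 with h' | h' | h'
  · exact not_subset hG.1 hG.2 h'
  · exact notMem_empty x (h' ▸ mem_inter.2 ⟨hx, hxy.2 hy⟩)
  · exact not_full hG.1 hG.2 h'

end PairOptimal

end

/-! ### Isolated and coisolated vertices. -/

section

variable {α : Type*} [DecidableEq α]

lemma erase_mem_memberSubfamily {i : α} {B : Finset (Finset α)} {x : Finset α} (hx : x ∈ B)
    (hi : i ∈ x) : x.erase i ∈ B.memberSubfamily i := by
  rw [mem_memberSubfamily, insert_erase hi]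
  exact ⟨hx, notMem_erase _ _⟩

/-- The residual configuration: all members of the left half avoiding `v` are present, and the
right half is isolated at `w`. -/
lemma pairOptimal_of_coisolated_of_isolated {C : Finset α} {i v w : α} {k : ℕ}
    {B : Finset (Finset α)} (hv : v ∉ C) (hi : i ∉ insert v C) (hw : w ∈ insert v C)
    (hk : k + 2 ≤ C.card) (hB : Optimal (insert i (insert v C)) (k + 2) B)
    (hsh : B.memberSubfamily i ⊆ ∂ (B.nonMemberSubfamily i))
    (hfill : fill (insert v C) (k + 1) (B.memberSubfamily i) ⊆ B.nonMemberSubfamily i)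
    (hco : C.powersetCard (k + 2) ⊆ B.nonMemberSubfamily i)
    (his : ∀ x ∈ B.memberSubfamily i, w ∉ x) :
    PairOptimal C (k + 1) ((B.nonMemberSubfamily i).memberSubfamily v)
      (swapFam v w (B.memberSubfamily i)) := by
  have hsub₀ := nonMemberSubfamily_subset hB.subset
  have hsub₁ := memberSubfamily_subset hB.subset
  have hcard := card_memberSubfamily_add_card_nonMemberSubfamily i B
  have hcs := card_shadow_of_member_subset hsh
  have hcf := card_fill_of_fill_subset hi hfill
  set B₀ := B.nonMemberSubfamily i
  set B₁ := B.memberSubfamily i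
  have hE := memberSubfamily_subset hsub₀
  -- Since `w` is isolated in `B₁`, `v` is isolated after the transposition, so the ground set
  -- shrinks to `C`.
  have hF : swapFam v w B₁ ⊆ C.powersetCard (k + 1) := fun x hx => by
    have h := mem_powersetCard.1 (swapFam_subset (mem_insert_self v C) hw hsub₁ hx)
    refine mem_powersetCard.2 ⟨?_, h.2⟩
    refine (subset_insert_iff_of_notMem fun hvx => ?_).1 h.1
    refine his _ (mem_swapFam.1 hx) ?_
    rw [mem_map_equiv, Equiv.symm_swap, Equiv.swap_apply_right]
    exact hvx
  have hK : B₀.nonMemberSubfamily v = C.powersetCard (k + 2) := by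
    refine subset_antisymm (nonMemberSubfamily_subset hsub₀) fun x hx => ?_
    exact mem_nonMemberSubfamily.2 ⟨hco hx, fun h => hv ((mem_powersetCard.1 hx).1 h)⟩
  have hKs : C.powersetCard (k + 1) ⊆ ∂ (C.powersetCard (k + 2)) :=
    powersetCard_subset_shadow hk
  have hcard₀ := card_memberSubfamily_add_card_nonMemberSubfamily v B₀
  have hcs₀ := card_shadow_of_member_subset (i := v) (B := B₀) (by
    rw [hK]; exact hE.trans hKs)
  have hcf₀ := card_fill_of_fill_subset (k := k + 1) (B := B₀) hv (by
    rw [hK]; exact fill_subset _ _ _)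
  rw [hK] at hcard₀ hcs₀ hcf₀
  set E := B₀.memberSubfamily v
  set F := swapFam v w B₁ with hFdef
  have hFc : F.card = B₁.card := card_mapFam _ _
  have hFs : (∂ F).card = (∂ B₁).card := by rw [hFdef, swapFam, shadow_mapFam, card_mapFam]
  have hFf : (fill (insert v C) (k + 1) B₁).card ≤ (fill C (k + 1) F).card := by
    rw [← fill_insert_eq (v := v) hF, ← card_mapFam (Equiv.swap v w).toEmbedding]
    have h := mapFam_fill_subset (Equiv.swap v w).toEmbedding (insert v C) (k + 1) B₁
    rw [map_swap_eq (mem_insert_self v C) hw] at h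
    exact card_le_card h
  have key {E' F'} (hE' : E' ⊆ C.powersetCard (k + 1)) (hF' : F' ⊆ C.powersetCard (k + 1))
      (hc : E'.card + F'.card = E.card + F.card) :
      (∂ E).card + (∂ F).card ≤ (∂ E').card + (∂ F').card ∧
        (fill C (k + 1) E').card + (fill C (k + 1) F').card ≤
          (fill C (k + 1) E).card + (fill C (k + 1) F).card := by
    have n₁ := notMem_of_subset_powersetCard hv (Subset.refl (C.powersetCard (k + 2)))
    have n₂ := notMem_of_subset_powersetCard hv hE'
    have g₀ := glue_subset hv (Subset.refl (C.powersetCard (k + 2))) hE'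
    have hF'' : F' ⊆ (insert v C).powersetCard (k + 1) :=
      hF'.trans (powersetCard_mono (subset_insert _ _))
    have n₃ := notMem_of_subset_powersetCard hi g₀
    have n₄ := notMem_of_subset_powersetCard hi hF''
    have g := glue_subset hi g₀ hF''
    -- Keeping all `(k + 2)`-subsets of `C` makes any pair `(E', F')` satisfy the gluing inclusions,
    -- so shadow and filled-set counts are additive in `E'` and `F'`.
    have hgc : (glue i (glue v (C.powersetCard (k + 2)) E') F').card = B.card := by
      rw [card_glue n₃ n₄, card_glue n₁ n₂]
      omega
    have hs := hB.shadow_le _ g hgc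
    have hf := hB.fill_le _ g hgc
    have hff : fill (insert v C) (k + 1) F' = fill C (k + 1) F' := fill_insert_eq hF'
    rw [card_shadow_glue n₃ n₄, card_shadow_glue n₁ n₂ (hE'.trans hKs)] at hs
    · rw [card_fill_glue hi n₃ n₄, card_fill_glue hv n₁ n₂ (fill_subset _ _ _), hff] at hf
      · simp only [Nat.add_assoc, Nat.reduceAdd] at hcf hcf₀ hf
        omega
      · rw [hff]
        exact (fill_subset _ _ _).trans subset_union_left
    · exact hF'.trans (hKs.trans (shadow_mono subset_union_left))
  exact ⟨hE, hF, fun E' hE' F' hF' hc => (key hE' hF' hc).1,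
    fun E' hE' F' hF' hc => (key hE' hF' hc).2⟩

/-- An optimal family has a vertex lying in no member, or one such that every `k`-set avoiding it
is a member. -/
theorem Optimal.exists_vertex {S : Finset α} {k : ℕ} {B : Finset (Finset α)}
    (hB : Optimal S k B) (hS : S.Nonempty) :
    ∃ j ∈ S, (∀ x ∈ B, j ∉ x) ∨ (S.erase j).powersetCard k ⊆ B := by
  induction hn : S.card generalizing S k B with
  | zero => exact absurd (card_eq_zero.1 hn) hS.ne_empty
  | succ n ih =>
  rcases B.eq_empty_or_nonempty with rfl | ⟨x₀, hx₀⟩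
  · obtain ⟨j, hj⟩ := hS
    exact ⟨j, hj, Or.inl (by simp)⟩
  obtain ⟨hx₀S, hx₀k⟩ := mem_powersetCard.1 (hB.subset hx₀)
  -- Here at most one `k`-set avoids a given vertex; for `k = n`, choosing `j` outside the member
  -- `x₀` makes that set `x₀` itself.
  by_cases hkn : n ≤ k
  · obtain ⟨j, hj, hjx⟩ : ∃ j ∈ S, n = k → j ∉ x₀ := by
      by_cases h : n = k
      · obtain ⟨j, hj⟩ : (S \ x₀).Nonempty := by
          rw [← card_pos, card_sdiff_of_subset hx₀S]
          omega
        exact ⟨j, (mem_sdiff.1 hj).1, fun _ => (mem_sdiff.1 hj).2⟩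
      · obtain ⟨j, hj⟩ := hS
        exact ⟨j, hj, fun h' => absurd h' h⟩
    refine ⟨j, hj, Or.inr fun x hx => ?_⟩
    obtain ⟨hxS, hxk⟩ := mem_powersetCard.1 hx
    have hc : (S.erase j).card = n := by rw [card_erase_of_mem hj, hn]; rfl
    have := card_le_card hxS
    have hxe : x = S.erase j := eq_of_subset_of_card_le hxS (by omega)
    have hx₀e : x₀ = S.erase j := eq_of_subset_of_card_le
      (fun a ha => mem_erase.2 ⟨fun h => hjx (by omega) (h ▸ ha), hx₀S ha⟩) (by omega)
    rwa [hxe, ← hx₀e]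
  rcases k with _ | k
  · obtain ⟨j, hj⟩ := hS
    refine ⟨j, hj, Or.inr fun x hx => ?_⟩
    have := (mem_powersetCard.1 hx).2
    rw [card_eq_zero] at this hx₀k
    rwa [this, ← hx₀k]
  by_contra hcon
  push Not at hcon
  obtain ⟨i, hi, hdeg⟩ := exists_low_degree hS hB.subset
  obtain ⟨S, hiS, rfl⟩ : ∃ S', i ∉ S' ∧ insert i S' = S :=
    ⟨S.erase i, notMem_erase _ _, insert_erase hi⟩
  have hcS : S.card = n := by
    rw [card_insert_of_notMem hiS] at hn
    omega
  rw [card_insert_of_notMem hiS] at hdeg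
  obtain ⟨hB₀, hB₁, hsh, hfill⟩ := hB.split hiS (by omega) hdeg
  have hSne : S.Nonempty := card_pos.1 (by omega)
  -- By `B₁ ⊆ ∂ B₀`, a vertex isolated in `B₀` is isolated in `B`.
  have not_isolated {v} (hv : v ∈ S) : ¬ ∀ x ∈ B.nonMemberSubfamily i, v ∉ x := by
    intro h
    obtain ⟨x, hx, hvx⟩ := (hcon v (mem_insert_of_mem hv)).1
    by_cases hix : i ∈ x
    · obtain ⟨s, hs, hxs⟩ := exists_subset_of_mem_shadow (hsh (erase_mem_memberSubfamily hx hix))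
      exact h s hs (hxs (mem_erase.2 ⟨fun hvi => hiS (hvi ▸ hv), hvx⟩))
    · exact h x (mem_nonMemberSubfamily.2 ⟨hx, hix⟩) hvx
  -- By `fill B₁ ⊆ B₀`, a vertex coisolated in `B₁` is coisolated in `B`.
  have not_coisolated {w} (hw : w ∈ S) : ¬ (S.erase w).powersetCard k ⊆ B.memberSubfamily i := by
    intro h
    refine (hcon w (mem_insert_of_mem hw)).2 fun x hx => ?_
    obtain ⟨hxS, hxk⟩ := mem_powersetCard.1 hx
    by_cases hix : i ∈ x
    · have : x.erase i ∈ B.memberSubfamily i := by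
        refine h (mem_powersetCard.2 ⟨?_, by rw [card_erase_of_mem hix, hxk]; rfl⟩)
        grind
      rw [mem_memberSubfamily, insert_erase hix] at this
      exact this.1
    · have hxS' : x ⊆ S.erase w := by grind
      refine (mem_nonMemberSubfamily.1 (hfill ?_)).1
      refine mem_fill.2 ⟨⟨hxS'.trans (erase_subset _ _), hxk⟩, fun p hp => h ?_⟩
      rw [mem_powersetCard, card_erase_of_mem hp, hxk]
      exact ⟨(erase_subset _ _).trans hxS', rfl⟩
  obtain ⟨v, hv, h | hco⟩ := ih hB₀ hSne hcS
  · exact not_isolated hv h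
  obtain ⟨w, hw, his | h⟩ := ih hB₁ hSne hcS
  swap
  · exact not_coisolated hw h
  have not_isolated_i : B.memberSubfamily i ≠ ∅ := fun h => by
    obtain ⟨x, hx, hix⟩ := (hcon i (mem_insert_self _ _)).1
    exact notMem_empty _ (h ▸ erase_mem_memberSubfamily hx hix)
  rcases k with _ | k
  · refine not_coisolated hw fun x hx => ?_
    obtain ⟨y, hy⟩ := nonempty_iff_ne_empty.2 not_isolated_i
    have h₁ := (mem_powersetCard.1 hx).2
    have h₂ := (mem_powersetCard.1 (hB₁.subset hy)).2
    rw [card_eq_zero] at h₁ h₂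
    rwa [h₁, ← h₂]
  obtain ⟨C, hvC, rfl⟩ : ∃ C, v ∉ C ∧ insert v C = S :=
    ⟨S.erase v, notMem_erase _ _, insert_erase hv⟩
  rw [erase_insert hvC] at hco
  rw [card_insert_of_notMem hvC] at hcS
  have hpair := pairOptimal_of_coisolated_of_isolated hvC hiS hw (by omega) hB hsh hfill hco his
  -- The four outcomes: `v` isolated in `B₀`; `B₀` full, so `i` coisolated in `B`; `B₁` empty, so
  -- `i` isolated; `w` coisolated in `B₁`.
  rcases hpair.eq_empty_or_eq_powersetCard with (h | h) | h | h
  · refine not_isolated hv fun x hx hvx => ?_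
    exact notMem_empty _ (h ▸ erase_mem_memberSubfamily hx hvx)
  · refine (hcon i (mem_insert_self _ _)).2 fun x hx => ?_
    rw [erase_insert hiS] at hx
    refine (mem_nonMemberSubfamily.1 (?_ : x ∈ B.nonMemberSubfamily i)).1
    obtain ⟨hxS, hxk⟩ := mem_powersetCard.1 hx
    by_cases hvx : v ∈ x
    · have : x.erase v ∈ (B.nonMemberSubfamily i).memberSubfamily v := by
        rw [h, mem_powersetCard, card_erase_of_mem hvx, hxk]
        exact ⟨by grind, rfl⟩
      rw [mem_memberSubfamily, insert_erase hvx] at this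
      exact this.1
    · exact hco (mem_powersetCard.2 ⟨(subset_insert_iff_of_notMem hvx).1 hxS, hxk⟩)
  · refine not_isolated_i (card_eq_zero.1 ?_)
    rw [← card_mapFam (Equiv.swap v w).toEmbedding, card_eq_zero]
    exact h
  · refine not_coisolated hw fun x hx => ?_
    obtain ⟨hxS, hxk⟩ := mem_powersetCard.1 hx
    have hx' : x ∈ (insert v C).powersetCard (k + 1) :=
      mem_powersetCard.2 ⟨hxS.trans (erase_subset _ _), hxk⟩
    have : x.map (Equiv.swap v w).toEmbedding ∈ swapFam v w (B.memberSubfamily i) := by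
      have hm := mem_powersetCard.1 (map_swap_mem_powersetCard (mem_insert_self v C) hw hx')
      rw [h, mem_powersetCard]
      refine ⟨(subset_insert_iff_of_notMem fun hvx => ?_).1 hm.1, hm.2⟩
      rw [mem_map_equiv, Equiv.symm_swap, Equiv.swap_apply_left] at hvx
      exact notMem_erase _ _ (hxS hvx)
    rwa [mem_swapFam, map_swap_map_swap] at this

/-! ### From special vertices to a labelling. -/

/-- An optimal family is an initial segment of the order on `k`-sets induced by a labelling of the
ground set: it is closed under passing to sets that lose the smallest differing element. -/
theorem Optimal.exists_labelling {S : Finset α} {k : ℕ} {B : Finset (Finset α)}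
    (hB : Optimal S k B) : ∃ f : α → ℕ, ∀ y ∈ B, ∀ x ∈ S.powersetCard k,
      (∃ i ∈ y, i ∉ x ∧ ∀ j ∈ symmDiff x y, f i ≤ f j) → x ∈ B := by
  induction hn : S.card generalizing S k B with
  | zero =>
    refine ⟨0, fun y hy x hx ⟨i, hi, _⟩ => ?_⟩
    have := (mem_powersetCard.1 (hB.subset hy)).1 hi
    rw [card_eq_zero.1 hn] at this
    exact absurd this (notMem_empty _)
  | succ n ih =>
  by_cases hk : n + 1 ≤ k
  · refine ⟨0, fun y hy x hx ⟨i, hi, hix, _⟩ => ?_⟩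
    obtain ⟨hxS, hxk⟩ := mem_powersetCard.1 hx
    rw [eq_of_subset_of_card_le hxS (by omega)] at hix
    exact absurd ((mem_powersetCard.1 (hB.subset hy)).1 hi) hix
  rcases k with _ | k
  · refine ⟨0, fun y hy x hx ⟨i, hi, _⟩ => ?_⟩
    have := (mem_powersetCard.1 (hB.subset hy)).2
    rw [card_eq_zero.1 this] at hi
    exact absurd hi (notMem_empty _)
  obtain ⟨j, hj, h⟩ := hB.exists_vertex (card_pos.1 (by omega))
  obtain ⟨S, hjS, rfl⟩ : ∃ S', j ∉ S' ∧ insert j S' = S :=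
    ⟨S.erase j, notMem_erase _ _, insert_erase hj⟩
  have hcS : S.card = n := by
    rw [card_insert_of_notMem hjS] at hn
    omega
  rcases h with his | hco
  · have hsub : B ⊆ S.powersetCard (k + 1) := fun x hx => by
      obtain ⟨h₁, h₂⟩ := mem_powersetCard.1 (hB.subset hx)
      exact mem_powersetCard.2 ⟨(subset_insert_iff_of_notMem (his x hx)).1 h₁, h₂⟩
    have hopt : Optimal S (k + 1) B := by
      refine ⟨hsub, fun B' h hc =>
        hB.shadow_le B' (h.trans (powersetCard_mono (subset_insert _ _))) hc, fun B' h hc => ?_⟩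
      have := hB.fill_le B' (h.trans (powersetCard_mono (subset_insert _ _))) hc
      rwa [fill_insert_eq h, fill_insert_eq hsub] at this
    obtain ⟨f, hf⟩ := ih hopt hcS
    -- The removed vertex gets the strictly smallest label. As no member contains `j`, a first
    -- difference lying in `y` excludes `j` from `x` too.
    refine ⟨fun a => if a = j then 0 else f a + 1, ?_⟩
    rintro y hy x hx ⟨i, hi, hix, hmin⟩
    obtain ⟨hxS, hxk⟩ := mem_powersetCard.1 hx
    have hij : i ≠ j := fun h => his y hy (h ▸ hi)
    have hjd : j ∉ symmDiff x y := fun h => by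
      have := hmin j h
      simp [hij] at this
    have hjx : j ∉ x := fun h => hjd (mem_symmDiff.2 (Or.inl ⟨h, his y hy⟩))
    refine hf y hy x
      (mem_powersetCard.2 ⟨(subset_insert_iff_of_notMem hjx).1 hxS, hxk⟩) ⟨i, hi, hix, ?_⟩
    intro a ha
    have haj : a ≠ j := fun h => hjd (h ▸ ha)
    simpa [hij, haj] using hmin a ha
  · rw [erase_insert hjS] at hco
    have hsub₀ := nonMemberSubfamily_subset hB.subset
    have hsub₁ := memberSubfamily_subset hB.subset
    have hK : B.nonMemberSubfamily j = S.powersetCard (k + 1) := by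
      refine subset_antisymm hsub₀ fun x hx => ?_
      exact mem_nonMemberSubfamily.2 ⟨hco hx, fun h => hjS ((mem_powersetCard.1 hx).1 h)⟩
    have hKs : S.powersetCard k ⊆ ∂ (S.powersetCard (k + 1)) :=
      powersetCard_subset_shadow (by omega)
    have hcard := card_memberSubfamily_add_card_nonMemberSubfamily j B
    have hcs := card_shadow_of_member_subset (i := j) (B := B) (by
      rw [hK]; exact hsub₁.trans hKs)
    have hcf := card_fill_of_fill_subset (k := k) (B := B) hjS (by
      rw [hK]; exact fill_subset _ _ _)
    rw [hK] at hcard hcs hcf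
    have n₁ := notMem_of_subset_powersetCard hjS (Subset.refl (S.powersetCard (k + 1)))
    have hopt : Optimal S k (B.memberSubfamily j) := by
      have key {B'} (h : B' ⊆ S.powersetCard k) (hc : B'.card = (B.memberSubfamily j).card) :
          (∂ (B.memberSubfamily j)).card ≤ (∂ B').card ∧
            (fill S k B').card ≤ (fill S k (B.memberSubfamily j)).card := by
        have n₂ := notMem_of_subset_powersetCard hjS h
        have g := glue_subset hjS (Subset.refl (S.powersetCard (k + 1))) h
        have hgc : (glue j (S.powersetCard (k + 1)) B').card = B.card := by
          rw [card_glue n₁ n₂]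
          omega
        have hs := hB.shadow_le _ g hgc
        have hf := hB.fill_le _ g hgc
        rw [card_shadow_glue n₁ n₂ (h.trans hKs)] at hs
        rw [card_fill_glue hjS n₁ n₂ (fill_subset _ _ _)] at hf
        omega
      exact ⟨hsub₁, fun B' h hc => (key h hc).1, fun B' h hc => (key h hc).2⟩
    obtain ⟨f, hf⟩ := ih hopt hcS
    -- Again `j` comes first: if `j ∉ x` then `x ∈ B` by coisolation; otherwise `j ∈ y` as well and
    -- the comparison passes to the link.
    refine ⟨fun a => if a = j then 0 else f a + 1, ?_⟩
    rintro y hy x hx ⟨i, hi, hix, hmin⟩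
    obtain ⟨hxS, hxk⟩ := mem_powersetCard.1 hx
    by_cases hjx : j ∈ x
    swap
    · exact hco (mem_powersetCard.2 ⟨(subset_insert_iff_of_notMem hjx).1 hxS, hxk⟩)
    have hij : i ≠ j := fun h => hix (h ▸ hjx)
    have hjy : j ∈ y := by
      by_contra hjy
      have := hmin j (mem_symmDiff.2 (Or.inl ⟨hjx, hjy⟩))
      simp [hij] at this
    have : x.erase j ∈ B.memberSubfamily j := by
      refine hf _ (erase_mem_memberSubfamily hy hjy) _ (mem_powersetCard.2 ⟨?_, ?_⟩)
        ⟨i, mem_erase.2 ⟨hij, hi⟩, fun h => hix (mem_of_mem_erase h), fun a ha => ?_⟩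
      · exact subset_insert_iff.1 hxS
      · rw [card_erase_of_mem hjx, hxk]
        rfl
      · have haj : a ≠ j := by
          rintro rfl
          simp [mem_symmDiff] at ha
        have := hmin a (by
          rw [mem_symmDiff] at ha ⊢
          grind)
        simpa [hij, haj] using this
    rw [mem_memberSubfamily, insert_erase hjx] at this
    exact this.1

end

/-! ### Neighbourhoods of layered sets in the cube. -/

variable {n k : ℕ}

lemma mem_nbhd {A : Finset (Cube n)} {x : Cube n} : x ∈ Cube.nbhd A ↔
    x ∈ A ∨ (∃ a ∉ x, insert a x ∈ A) ∨ ∃ a ∈ x, x.erase a ∈ A := by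
  rw [Cube.nbhd, mem_filter, and_iff_right (mem_univ x)]
  simp only [Cube.cubeDist]
  constructor
  · rintro ⟨y, hy, h⟩
    rcases Nat.le_one_iff_eq_zero_or_eq_one.1 h with h | h
    · rw [card_eq_zero, ← bot_eq_empty, symmDiff_eq_bot] at h
      exact Or.inl (h ▸ hy)
    · obtain ⟨a, ha⟩ := card_eq_one.1 h
      have hya : y = symmDiff x {a} := by rw [← ha, symmDiff_symmDiff_cancel_left]
      by_cases hax : a ∈ x
      · refine Or.inr (Or.inr ⟨a, hax, ?_⟩)
        convert! hy using 1
        rw [hya]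
        ext b
        simp only [mem_symmDiff, mem_erase, mem_singleton]
        grind
      · refine Or.inr (Or.inl ⟨a, hax, ?_⟩)
        convert! hy using 1
        rw [hya]
        ext b
        simp only [mem_symmDiff, mem_insert, mem_singleton]
        grind
  · rintro (h | ⟨a, ha, h⟩ | ⟨a, ha, h⟩)
    · exact ⟨x, h, by simp⟩
    · refine ⟨_, h, (card_le_card (t := {a}) fun b hb => ?_).trans (card_singleton a).le⟩
      simp only [mem_symmDiff, mem_insert, mem_singleton] at hb ⊢
      grind
    · refine ⟨_, h, (card_le_card (t := {a}) fun b hb => ?_).trans (card_singleton a).le⟩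
      simp only [mem_symmDiff, mem_erase, mem_singleton] at hb ⊢
      grind

lemma mem_layersGE {x : Cube n} : x ∈ Cube.layersGE n k ↔ k ≤ x.card := by
  simp [Cube.layersGE]

/-- All layers above `k`, together with the family `B` of `k`-sets. -/
def upward (n k : ℕ) (B : Finset (Cube n)) : Finset (Cube n) := Cube.layersGE n (k + 1 : ℕ) ∪ B

lemma mem_upward {B : Finset (Cube n)} {x : Cube n} :
    x ∈ upward n k B ↔ k + 1 ≤ x.card ∨ x ∈ B := by
  rw [upward, mem_union, mem_layersGE]

lemma card_upward {B : Finset (Cube n)} (hB : B ⊆ powersetCard k univ) :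
    (upward n k B).card = (Cube.layersGE n (k + 1 : ℕ)).card + B.card := by
  refine card_union_of_disjoint (disjoint_left.2 fun x hx hxB => ?_)
  have := mem_layersGE.1 hx
  have := (mem_powersetCard.1 (hB hxB)).2
  omega

/-- With `k < n`, every `k`-set lies below a `(k + 1)`-set, so the whole of layer `k` is covered
whatever `B` is; only layer `k - 1` depends on `B`, through its shadow. -/
lemma card_nbhd_upward {B : Finset (Cube n)} (hB : B ⊆ powersetCard k univ) (hk : k < n) :
    (Cube.nbhd (upward n k B)).card = (Cube.layersGE n k).card + (∂ B).card := by
  have hBk {x} (hx : x ∈ B) : x.card = k := (mem_powersetCard.1 (hB hx)).2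
  rw [← card_union_of_disjoint]
  · congr 1
    ext x
    rw [mem_nbhd, mem_union, mem_layersGE, mem_shadow_iff_insert_mem]
    simp only [mem_upward]
    constructor
    · rintro ((h | h) | ⟨a, ha, h | h⟩ | ⟨a, ha, h | h⟩)
      · exact Or.inl (by omega)
      · exact Or.inl (hBk h).ge
      · rw [card_insert_of_notMem ha] at h
        exact Or.inl (by omega)
      · exact Or.inr ⟨a, ha, h⟩
      · rw [card_erase_of_mem ha] at h
        exact Or.inl (by omega)
      · have := hBk h
        rw [card_erase_of_mem ha] at this
        exact Or.inl (by omega)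
    · rintro (h | ⟨a, ha, h⟩)
      · rcases h.lt_or_eq with h | h
        · exact Or.inl (Or.inl h)
        · obtain ⟨a, ha⟩ : ∃ a, a ∉ x := by
            by_contra! hc
            have := eq_univ_iff_forall.2 hc
            rw [this, card_univ, Fintype.card_fin] at h
            omega
          exact Or.inr (Or.inl ⟨a, ha, Or.inl (by rw [card_insert_of_notMem ha]; omega)⟩)
      · exact Or.inr (Or.inl ⟨a, ha, Or.inr h⟩)
  · refine disjoint_left.2 fun x hx hxB => ?_
    obtain ⟨a, ha, h⟩ := mem_shadow_iff_insert_mem.1 hxB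
    have h₁ := mem_layersGE.1 hx
    have h₂ := hBk h
    rw [card_insert_of_notMem ha] at h₂
    omega

/-- With `0 < k`, layer `k` is covered from layer `k - 1`; a `(k + 1)`-set is missed exactly when
all its `k`-subsets lie in `B`. -/
lemma card_nbhd_compl_upward {B : Finset (Cube n)} (hB : B ⊆ powersetCard k univ) (hk : 0 < k) :
    (Cube.nbhd (upward n k B)ᶜ).card + (fill univ k B).card =
      (univ.filter fun x : Cube n => x.card ≤ k).card +
        (powersetCard (k + 1) (univ : Finset (Fin n))).card := by
  have hBk {x} (hx : x ∈ B) : x.card = k := (mem_powersetCard.1 (hB hx)).2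
  have hmem {y : Cube n} : y ∈ (upward n k B)ᶜ ↔ y.card ≤ k ∧ y ∉ B := by
    rw [mem_compl, mem_upward, not_or, not_le, Nat.lt_succ_iff]
  have : Cube.nbhd (upward n k B)ᶜ = (univ.filter fun x : Cube n => x.card ≤ k) ∪
      (powersetCard (k + 1) univ \ fill univ k B) := by
    ext x
    simp only [mem_nbhd, mem_union, mem_filter, mem_univ, true_and, mem_sdiff,
      mem_powersetCard_univ, hmem]
    constructor
    · rintro (h | ⟨a, ha, h, -⟩ | ⟨a, ha, h, h'⟩)
      · exact Or.inl h.1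
      · rw [card_insert_of_notMem ha] at h
        exact Or.inl (by omega)
      · rw [card_erase_of_mem ha] at h
        by_cases hx : x.card ≤ k
        · exact Or.inl hx
        · exact Or.inr ⟨by omega, fun hf => h' ((mem_fill.1 hf).2 a ha)⟩
    · rintro (h | ⟨h, h'⟩)
      · rcases h.lt_or_eq with h | h
        · exact Or.inl ⟨h.le, fun hx => h.ne (hBk hx)⟩
        · obtain ⟨a, ha⟩ : x.Nonempty := card_pos.1 (by omega)
          have hc := card_erase_of_mem ha
          exact Or.inr (Or.inr ⟨a, ha, by omega, fun hx => by have := hBk hx; omega⟩)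
      · rw [mem_fill] at h'
        push Not at h'
        obtain ⟨a, ha, hx⟩ := h' ⟨subset_univ _, h⟩
        have hc := card_erase_of_mem ha
        exact Or.inr (Or.inr ⟨a, ha, by omega, hx⟩)
  rw [this, card_union_of_disjoint, add_assoc, card_sdiff_add_card_eq_card (fill_subset _ _ _)]
  refine disjoint_left.2 fun x hx hx' => ?_
  have h₁ := (mem_filter.1 hx).2
  have h₂ := (mem_powersetCard.1 (mem_sdiff.1 hx').1).2
  omega

/-- If `N(A)` and `N(Aᶜ)` are minimal, the incomplete layer of `A` is an optimal family. -/
lemma optimal_of_nbhdMinimal {B : Finset (Cube n)} (hk : k ≤ n) (hB : B ⊆ powersetCard k univ)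
    (hN : Cube.NbhdMinimal (upward n k B)) (hNc : Cube.NbhdMinimal (upward n k B)ᶜ) :
    Optimal univ k B := by
  by_cases hkn : 0 < k ∧ k < n
  · refine ⟨hB, fun B' hB' hc => ?_, fun B' hB' hc => ?_⟩
    · have := hN (upward n k B') (by rw [card_upward hB', card_upward hB, hc])
      rw [card_nbhd_upward hB' hkn.2, card_nbhd_upward hB hkn.2] at this
      omega
    · have := hNc (upward n k B')ᶜ (by
        rw [card_compl, card_compl, card_upward hB', card_upward hB, hc])
      have h₁ := card_nbhd_compl_upward hB hkn.1
      have h₂ := card_nbhd_compl_upward hB' hkn.1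
      omega
  -- In the extreme layers there is a single `k`-set, so the size of `B` determines `B`.
  · have hone : (powersetCard k (univ : Finset (Fin n))).card = 1 := by
      rw [card_powersetCard, card_univ, Fintype.card_fin]
      obtain rfl | rfl : k = 0 ∨ k = n := by omega
      · exact Nat.choose_zero_right _
      · exact Nat.choose_self _
    obtain ⟨a, ha⟩ := card_eq_one.1 hone
    have heq {B'} (hB' : B' ⊆ powersetCard k univ) (hc : B'.card = B.card) : B' = B := by
      rw [ha, subset_singleton_iff] at hB hB'
      rcases hB with rfl | rfl <;> rcases hB' with rfl | rfl <;> simp_all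
    exact ⟨hB, fun B' hB' hc => by rw [heq hB' hc], fun B' hB' hc => by rw [heq hB' hc]⟩

/-! ### Passage to the simplicial order. -/

/-- The automorphism of the cube which permutes the ground set and takes complements. -/
def permCompl (s : Equiv.Perm (Fin n)) : Cube n ≃ Cube n :=
  (Equiv.finsetCongr s).trans (Function.Involutive.toPerm compl compl_involutive)

lemma permCompl_apply (s : Equiv.Perm (Fin n)) (x : Cube n) :
    permCompl s x = (x.map s.toEmbedding)ᶜ := rfl

lemma mem_permCompl {s : Equiv.Perm (Fin n)} {x : Cube n} {i : Fin n} :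
    i ∈ permCompl s x ↔ s.symm i ∉ x := by
  rw [permCompl_apply, mem_compl, mem_map_equiv]

lemma cubeDist_permCompl (s : Equiv.Perm (Fin n)) (x y : Cube n) :
    Cube.cubeDist (permCompl s x) (permCompl s y) = Cube.cubeDist x y := by
  rw [Cube.cubeDist, Cube.cubeDist, permCompl_apply, permCompl_apply, compl_symmDiff_compl,
    map_eq_image, map_eq_image, ← image_symmDiff _ _ s.toEmbedding.injective, ← map_eq_image,
    card_map]

lemma card_permCompl (s : Equiv.Perm (Fin n)) (x : Cube n) :
    (permCompl s x).card + x.card = n := by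
  have := card_compl_add_card (x.map s.toEmbedding)
  rwa [card_map, Fintype.card_fin] at this

/-- Complementation sends high layers to low ones, and turns "the first difference lies in `y`" into
"the first difference lies in the complement of `x`", which is the lexicographic condition. -/
theorem exists_initialSegment_of_optimal {B : Finset (Cube n)} (hB : Optimal univ k B) :
    ∃ C : Finset (Cube n), Cube.IsSimInitialSegment C ∧ Cube.Isomorphic (upward n k B) C := by
  obtain ⟨f, hf⟩ := hB.exists_labelling
  -- Labels may coincide; any sorting permutation works, because the labelling property asks only
  -- for weak inequalities.
  set s := Tuple.sort f
  have hs : Monotone (f ∘ s) := Tuple.monotone_sort f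
  refine ⟨_, ?_, permCompl s.symm, cubeDist_permCompl _, rfl⟩
  intro y hy x hxy
  obtain ⟨y, hyA, rfl⟩ := mem_map.1 hy
  obtain ⟨x, rfl⟩ := (permCompl s.symm).surjective x
  refine mem_map_of_mem _ ?_
  rw [Equiv.coe_toEmbedding] at hxy
  have hcx := card_permCompl s.symm x
  have hcy := card_permCompl s.symm y
  rw [mem_upward] at hyA ⊢
  have hyk : k ≤ y.card := by
    rcases hyA with hy | hy
    · omega
    · exact (mem_powersetCard.1 (hB.subset hy)).2.ge
  rcases hxy with h | ⟨h, i, hix, hi, hmin⟩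
  · exact Or.inl (by omega)
  · by_cases hxk : k + 1 ≤ x.card
    · exact Or.inl hxk
    · refine Or.inr (hf y (hyA.resolve_left (by omega)) x
        (mem_powersetCard.2 ⟨subset_univ _, by omega⟩) ⟨s i, ?_, ?_, fun j hj => ?_⟩)
      · simp only [mem_symmDiff, mem_permCompl, Equiv.symm_symm] at hi hix
        tauto
      · simpa only [mem_permCompl, Equiv.symm_symm] using hix
      · have : i ≤ s.symm j := by
          refine hmin _ ?_
          simp only [mem_symmDiff, mem_permCompl, Equiv.symm_symm, Equiv.apply_symm_apply] at hj ⊢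
          tauto
        simpa using hs this

end LayerFamily

open LayerFamily in
theorem corollary12 (n : ℕ) (A : Finset (Cube n)) (r : ℤ)
    (hlow : Cube.layersGE n r ⊆ A) (hupp : A ⊆ Cube.layersGE n (r - 1))
    (hN : Cube.NbhdMinimal A) (hNc : Cube.NbhdMinimal Aᶜ) :
    ∃ C : Finset (Cube n), Cube.IsSimInitialSegment C ∧ Cube.Isomorphic A C := by
  have isom_self : Cube.Isomorphic A A := ⟨Equiv.refl _, fun _ _ => rfl, by simp⟩
  -- For `r ≤ 0` the set `A` is the whole cube; at the other extreme, `r - 1 > n`, it is empty.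
  rcases le_or_gt r 0 with hr | hr
  · refine ⟨A, fun y _ x _ => hlow ?_, isom_self⟩
    simp only [Cube.layersGE, Finset.mem_filter, Finset.mem_univ, true_and]
    omega
  obtain ⟨k, rfl⟩ : ∃ k : ℕ, r = k + 1 := ⟨(r - 1).toNat, by omega⟩
  by_cases hk : k ≤ n
  · set B := A.filter fun x => x.card = k with hBdef
    have hB : B ⊆ Finset.powersetCard k Finset.univ := fun x hx =>
      Finset.mem_powersetCard.2 ⟨Finset.subset_univ _, (Finset.mem_filter.1 hx).2⟩
    have hA : A = upward n k B := by
      ext x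
      rw [mem_upward, hBdef, Finset.mem_filter]
      constructor
      · intro hx
        have := hupp hx
        rw [add_sub_cancel_right, mem_layersGE] at this
        rcases this.lt_or_eq with h | h
        · exact Or.inl h
        · exact Or.inr ⟨hx, h.symm⟩
      · rintro (h | h)
        · exact hlow (by exact_mod_cast mem_layersGE.2 h)
        · exact h.1
    rw [hA] at hN hNc ⊢
    exact exists_initialSegment_of_optimal (optimal_of_nbhdMinimal hk hB hN hNc)
  · refine ⟨A, fun y hy => ?_, isom_self⟩
    have h₁ := hupp hy
    rw [add_sub_cancel_right, mem_layersGE] at h₁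
    have h₂ := Finset.card_le_univ y
    rw [Fintype.card_fin] at h₂
    omega
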